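/- Let $k$ be an algebraically closed field of characteristic $0$ and let $n\ge 0$. The Waring rank of a form $F\in k[X_1,\dots,X_n]$ of degree $d$ is the smallest $r$ such that $F=L_1^d+\dots+L_r^d$ for linear forms $L_1,\dots,L_r$. A property holds for the generic symmetric form of degree $d$ if it holds on a nonempty Zariski open subset of the vector space of symmetric forms of degree $d$ in $X_1,\dots,X_n$. Then the generic symmetric quartic in $n$ variables has Waring rank at most $$\binom{n+1}{2}+1=\binom{n+2}{2}-n,$$ and the generic symmetric quintic in $n$ variables has Waring rank at most $\binom{n+2}{2}$. Moreover, write $p_m=X_1^m+\dots+X_n^m$ and $h_1=p_1$, and consider the families $$F_4(\alpha)=(\alpha_0h_1)^4+\sum_{i=1}^n(\alpha_1h_1+\alpha_2X_i)^4+\sum_{1\le i<j\le n}(\alpha_3h_1+\alpha_4X_i+\alpha_4X_j)^4,\qquad \alpha\in k^5,$$ $$F_5(\alpha)=(\alpha_0h_1)^5+\sum_{i=1}^n(\alpha_1h_1+\alpha_2X_i)^5+\sum_{1\le i<j\le n}(\alpha_3h_1+\alpha_4X_i+\alpha_4X_j)^5+\sum_{i=1}^n(\alpha_5h_1+\alpha_6X_i)^5,\qquad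 \alpha\in k^7.$$ Every member of the family $F_4$ (respectively $F_5$) is a symmetric form of degree $4$ (respectively $5$) whose Waring rank is at most the above bound. There are polynomials $c_j$ in $\alpha$ such that $F_4(\alpha)=\sum_j c_j(\alpha)b_j$ for all $\alpha$, where $(b_j)=(p_4,\,p_3p_1,\,p_2^2,\,p_2p_1^2,\,p_1^4)$ (respectively $F_5(\alpha)=\sum_j c_j(\alpha)b_j$, where $(b_j)=(p_5,\,p_4p_1,\,p_3p_2,\,p_3p_1^2,\,p_2^2p_1,\,p_2p_1^3,\,p_1^5)$), and whose Jacobian determinant $\det(\partial c_j/\partial\alpha_i)$ is not the zero polynomial. The map $\alpha\mapsto F_4(\alpha)$ (respectively $\alpha\mapsto F_5(\alpha)$) into the space of symmetric quartics (respectively quintics) is dominant, that is, has Zariski dense image, and the generic symmetric quartic (respectively quintic) is of the form $F_4(\alpha)$ (respectively $F_5(\alpha)$). -/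

import Mathlib

open MvPolynomial

/-- The space of symmetric forms (homogeneous symmetric polynomials) of degree `d` in `n`
variables over `k`. -/
noncomputable def symmetricForms (k : Type*) [Field k] (n d : ℕ) :
    Submodule k (MvPolynomial (Fin n) k) :=
  homogeneousSubmodule (Fin n) k d ⊓ Subalgebra.toSubmodule (symmetricSubalgebra (Fin n) k)

/-- `F` is a sum of `r` many `d`-th powers of linear forms. -/
def IsPowerSum {k : Type*} [Field k] {n : ℕ} (d r : ℕ) (F : MvPolynomial (Fin n) k) : Prop :=
  ∃ L : Fin r → MvPolynomial (Fin n) k, (∀ i, (L i).IsHomogeneous 1) ∧ F = ∑ i, L i ^ d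

/-- The Waring rank of a form `F` of degree `d`: the smallest `r` such that `F` is a sum of `r`
many `d`-th powers of linear forms (and `⊤` if there is no such `r`). -/
noncomputable def waringRank {k : Type*} [Field k] {n : ℕ} (d : ℕ) (F : MvPolynomial (Fin n) k) :
    ℕ∞ :=
  sInf {r : ℕ∞ | ∃ m : ℕ, r = (m : ℕ∞) ∧ IsPowerSum d m F}

/-- The value at `F` of a polynomial `g` in the coefficients of `F`. -/
noncomputable def evalCoeffs {k : Type*} [Field k] {n : ℕ} (g : MvPolynomial (Fin n →₀ ℕ) k)
    (F : MvPolynomial (Fin n) k) : k :=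
  eval (fun m => coeff m F) g

/-- `P` holds for the generic element of the linear system `V` of polynomials: it holds on a
nonempty principal Zariski open subset of `V`.  (Every nonempty Zariski open subset contains such
a set, and for finite-dimensional `V` the polynomials in the coefficients of `F ∈ V` are all the
polynomial functions on `V`.) -/
def HoldsGenerically {k : Type*} [Field k] {n : ℕ} (V : Submodule k (MvPolynomial (Fin n) k))
    (P : MvPolynomial (Fin n) k → Prop) : Prop :=
  ∃ g : MvPolynomial (Fin n →₀ ℕ) k,
    (∃ F ∈ V, evalCoeffs g F ≠ 0) ∧ ∀ F ∈ V, evalCoeffs g F ≠ 0 → P F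

/-- `Φ` maps into `V` with Zariski dense image: a polynomial function that vanishes on the image
of `Φ` vanishes on `V`. -/
def IsDominantInto {k : Type*} [Field k] {n : ℕ} {A : Type*}
    (V : Submodule k (MvPolynomial (Fin n) k)) (Φ : A → MvPolynomial (Fin n) k) : Prop :=
  (∀ a, Φ a ∈ V) ∧
    ∀ g : MvPolynomial (Fin n →₀ ℕ) k,
      (∀ a, evalCoeffs g (Φ a) = 0) → ∀ F ∈ V, evalCoeffs g F = 0

/-- The linear form `h₁ = X₁ + ⋯ + Xₙ`. -/
noncomputable def sumVars (k : Type*) [Field k] (n : ℕ) : MvPolynomial (Fin n) k := ∑ i, X i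

/-- `(α₀ h₁)⁴ + ∑ᵢ (α₁ h₁ + α₂ Xᵢ)⁴ + ∑_{i < j} (α₃ h₁ + α₄ Xᵢ + α₄ Xⱼ)⁴`. -/
noncomputable def quarticFamily {k : Type*} [Field k] (n : ℕ) (α : Fin 5 → k) :
    MvPolynomial (Fin n) k :=
  (C (α 0) * sumVars k n) ^ 4
    + ∑ i, (C (α 1) * sumVars k n + C (α 2) * X i) ^ 4
    + ∑ i, ∑ j ∈ Finset.Ioi i, (C (α 3) * sumVars k n + C (α 4) * X i + C (α 4) * X j) ^ 4

/-- `(α₀ h₁)⁵ + ∑ᵢ (α₁ h₁ + α₂ Xᵢ)⁵ + ∑_{i < j} (α₃ h₁ + α₄ Xᵢ + α₄ Xⱼ)⁵ + ∑ᵢ (α₅ h₁ + α₆ Xᵢ)⁵`. -/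
noncomputable def quinticFamily {k : Type*} [Field k] (n : ℕ) (α : Fin 7 → k) :
    MvPolynomial (Fin n) k :=
  (C (α 0) * sumVars k n) ^ 5
    + ∑ i, (C (α 1) * sumVars k n + C (α 2) * X i) ^ 5
    + ∑ i, ∑ j ∈ Finset.Ioi i, (C (α 3) * sumVars k n + C (α 4) * X i + C (α 4) * X j) ^ 5
    + ∑ i, (C (α 5) * sumVars k n + C (α 6) * X i) ^ 5

/-- The products of power sums `p₄, p₃p₁, p₂², p₂p₁², p₁⁴`. -/
noncomputable def quarticProducts (k : Type*) [Field k] (n : ℕ) :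
    Fin 5 → MvPolynomial (Fin n) k :=
  let p := psum (Fin n) k
  ![p 4, p 3 * p 1, p 2 ^ 2, p 2 * p 1 ^ 2, p 1 ^ 4]

/-- The products of power sums `p₅, p₄p₁, p₃p₂, p₃p₁², p₂²p₁, p₂p₁³, p₁⁵`. -/
noncomputable def quinticProducts (k : Type*) [Field k] (n : ℕ) :
    Fin 7 → MvPolynomial (Fin n) k :=
  let p := psum (Fin n) k
  ![p 5, p 4 * p 1, p 3 * p 2, p 3 * p 1 ^ 2, p 2 ^ 2 * p 1, p 2 * p 1 ^ 3, p 1 ^ 5]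

/-- The polynomials `c j` in the parameters are coordinates of the family `Φ` with respect to the
forms `b j`, that is `Φ(α) = ∑ⱼ cⱼ(α) bⱼ`. -/
def AreCoordinates {k : Type*} [Field k] {n N : ℕ} (Φ : (Fin N → k) → MvPolynomial (Fin n) k)
    (b : Fin N → MvPolynomial (Fin n) k) (c : Fin N → MvPolynomial (Fin N) k) : Prop :=
  ∀ α, Φ α = ∑ j, C (eval α (c j)) * b j

/-- The Jacobian determinant `det (∂cⱼ/∂αᵢ)`. -/
noncomputable def jacobianDet {k : Type*} [Field k] {N : ℕ} (c : Fin N → MvPolynomial (Fin N) k) :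
    MvPolynomial (Fin N) k :=
  (Matrix.of fun i j => pderiv i (c j)).det

/-! ### Products of power sums span the symmetric forms. -/

section PowerSums

variable (k : Type*) [Field k] (n : ℕ)

/-! In characteristic 0 the products of power sums indexed by the partitions of `d` span the
symmetric forms of degree `d`: five products for quartics and seven for quintics, as many as the
families have parameters. Expanding a family in these products turns membership into a square
polynomial system, which is solved explicitly off a hypersurface.

The systems are nearly triangular. For quartics, `p₂²` gives `α₄`, then `p₄` gives `α₂`; `p₃p₁`
makes `α₁` affine in `α₃`, and `p₂p₁²` leaves a quadratic in `α₃`. For quintics, `p₃p₂` and `p₂²p₁`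
give `α₄` and `α₃`; four of the remaining equations ask for two weighted points with prescribed
moments, which is Sylvester's decomposition of a binary cubic into two cubes
(`exists_two_point_moments`) and the reason for the second sum over single variables. In both cases
`α₀` absorbs the coefficient of `p₁ᵈ`.

`holdsGenerically_exists_eq` carries solvability over to forms, even for small `n`, where the
products are linearly dependent. Density follows from genericity, the rank bounds from counting
summands; the Jacobian is evaluated at one point. -/

theorem isHomogeneous_psum (m : ℕ) : (psum (Fin n) k m).IsHomogeneous m :=
  IsHomogeneous.sum _ _ _ fun i _ => by simpa using (isHomogeneous_X k i).pow m

theorem isHomogeneous_multiset_prod_psum (s : Multiset ℕ) :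
    (s.map (psum (Fin n) k)).prod.IsHomogeneous s.sum := by
  induction s using Multiset.induction with
  | empty => simpa using isHomogeneous_one (Fin n) k
  | cons a s ih => simpa using (isHomogeneous_psum k n a).mul ih

/-- Newton's identity expresses `m * esymm m` through power sums and lower elementary symmetric
polynomials; characteristic 0 permits division by `m`. -/
theorem esymm_mem_adjoin_psum [CharZero k] (m : ℕ) :
    esymm (Fin n) k m ∈ Algebra.adjoin k (psum (Fin n) k '' {a | 1 ≤ a}) := by
  induction m using Nat.strong_induction_on with
  | _ m ih =>
    rcases Nat.eq_zero_or_pos m with rfl | hm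
    · rw [esymm_zero]
      exact one_mem _
    · have hne : (m : k) ≠ 0 := Nat.cast_ne_zero.2 hm.ne'
      have h : esymm (Fin n) k m = (m : k)⁻¹ • ((m : MvPolynomial (Fin n) k) * esymm (Fin n) k m) := by
        rw [← map_natCast (C : k →+* MvPolynomial (Fin n) k), ← smul_eq_C_mul, smul_smul,
          inv_mul_cancel₀ hne, one_smul]
      rw [h, mul_esymm_eq_sum]
      refine Subalgebra.smul_mem _ (mul_mem (pow_mem (neg_mem (one_mem _)) _)
        (sum_mem fun a ha => mul_mem (mul_mem (pow_mem (neg_mem (one_mem _)) _) (ih _ ?_)) ?_)) _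
      · exact (Finset.mem_filter.1 ha).2
      · have := Finset.HasAntidiagonal.mem_antidiagonal.1 (Finset.mem_filter.1 ha).1
        have := (Finset.mem_filter.1 ha).2
        exact Algebra.subset_adjoin ⟨_, show 1 ≤ a.2 by omega, rfl⟩

theorem symmetricSubalgebra_le_adjoin_psum [CharZero k] :
    symmetricSubalgebra (Fin n) k ≤ Algebra.adjoin k (psum (Fin n) k '' {a | 1 ≤ a}) := by
  intro F hF
  obtain ⟨P, hP⟩ := esymmAlgHom_fin_surjective k (le_refl n) ⟨F, hF⟩
  have hF' : F = aeval (fun i : Fin n => esymm (Fin n) k (i + 1)) P := by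
    rw [← esymmAlgHom_apply, hP]
  have hr : F ∈ Algebra.adjoin k (Set.range fun i : Fin n => esymm (Fin n) k (i + 1)) := by
    rw [hF', Algebra.adjoin_range_eq_range_aeval]
    exact ⟨P, rfl⟩
  exact Algebra.adjoin_le (by rintro _ ⟨i, rfl⟩; exact esymm_mem_adjoin_psum k n _) hr

/-- A symmetric form of degree `d` is a linear combination of the products of power sums
indexed by the partitions of `d`. -/
theorem symmetricForms_le_span_psum [CharZero k] (d : ℕ) :
    symmetricForms k n d ≤ Submodule.span k {f | ∃ l : List ℕ, (∀ a ∈ l, 1 ≤ a) ∧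
      l.Pairwise (· ≥ ·) ∧ l.sum = d ∧ f = (l.map (psum (Fin n) k)).prod} := by
  rintro F ⟨hd, hs⟩
  have hF : F ∈ Submodule.span k
      (Submonoid.closure (psum (Fin n) k '' {a | 1 ≤ a}) : Set (MvPolynomial (Fin n) k)) := by
    rw [← Algebra.adjoin_eq_span]
    exact symmetricSubalgebra_le_adjoin_psum k n hs
  have hc : homogeneousComponent d F = F := by
    rw [homogeneousComponent_of_mem hd, if_pos rfl]
  rw [← hc]
  -- Taking the degree `d` component fixes the products of degree `d` and kills all others.
  suffices h : Submodule.span k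
      (Submonoid.closure (psum (Fin n) k '' {a | 1 ≤ a}) : Set (MvPolynomial (Fin n) k)) ≤
      (Submodule.span k {f | ∃ l : List ℕ, (∀ a ∈ l, 1 ≤ a) ∧ l.Pairwise (· ≥ ·) ∧ l.sum = d ∧
        f = (l.map (psum (Fin n) k)).prod}).comap (homogeneousComponent d) from h hF
  refine Submodule.span_le.2 fun f hf => ?_
  obtain ⟨t, ht, rfl⟩ := Submonoid.exists_multiset_of_mem_closure hf
  obtain ⟨s, hs, rfl⟩ : ∃ s : Multiset ℕ, (∀ a ∈ s, 1 ≤ a) ∧ s.map (psum (Fin n) k) = t := by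
    clear hf
    induction t using Multiset.induction with
    | empty => exact ⟨0, by simp, rfl⟩
    | cons y t ih =>
      obtain ⟨s, hs, rfl⟩ := ih fun y hy => ht y (Multiset.mem_cons_of_mem hy)
      obtain ⟨a, ha, rfl⟩ := ht y (Multiset.mem_cons_self _ _)
      exact ⟨a ::ₘ s, by simpa using ⟨ha, hs⟩, by simp⟩
  simp only [Submodule.comap_coe, Set.mem_preimage, SetLike.mem_coe]
  rw [homogeneousComponent_of_mem (isHomogeneous_multiset_prod_psum k n s)]
  split_ifs with h
  · refine Submodule.subset_span ⟨s.sort (· ≥ ·), by simpa using hs, s.pairwise_sort _, ?_, ?_⟩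
    · rw [← Multiset.sum_coe, Multiset.sort_eq, h]
    · rw [← Multiset.prod_coe, ← Multiset.map_coe, Multiset.sort_eq]
  · exact zero_mem _

theorem quarticProducts_mem (j : Fin 5) : quarticProducts k n j ∈ symmetricForms k n 4 := by
  have h (m : ℕ) := isHomogeneous_psum k n m
  have hs (m : ℕ) : psum (Fin n) k m ∈ symmetricSubalgebra (Fin n) k := psum_isSymmetric _ _ m
  refine ⟨?_, ?_⟩
  · fin_cases j
    exacts [h 4, (h 3).mul (h 1), (h 2).pow 2, (h 2).mul ((h 1).pow 2), (h 1).pow 4]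
  · change _ ∈ symmetricSubalgebra (Fin n) k
    fin_cases j
    exacts [hs 4, mul_mem (hs 3) (hs 1), pow_mem (hs 2) 2, mul_mem (hs 2) (pow_mem (hs 1) 2),
      pow_mem (hs 1) 4]

theorem quinticProducts_mem (j : Fin 7) : quinticProducts k n j ∈ symmetricForms k n 5 := by
  have h (m : ℕ) := isHomogeneous_psum k n m
  have hs (m : ℕ) : psum (Fin n) k m ∈ symmetricSubalgebra (Fin n) k := psum_isSymmetric _ _ m
  refine ⟨?_, ?_⟩
  · fin_cases j
    exacts [h 5, (h 4).mul (h 1), (h 3).mul (h 2), (h 3).mul ((h 1).pow 2),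
      ((h 2).pow 2).mul (h 1), (h 2).mul ((h 1).pow 3), (h 1).pow 5]
  · change _ ∈ symmetricSubalgebra (Fin n) k
    fin_cases j
    exacts [hs 5, mul_mem (hs 4) (hs 1), mul_mem (hs 3) (hs 2), mul_mem (hs 3) (pow_mem (hs 1) 2),
      mul_mem (pow_mem (hs 2) 2) (hs 1), mul_mem (hs 2) (pow_mem (hs 1) 3), pow_mem (hs 1) 5]

theorem symmetricForms_four_le_span [CharZero k] :
    symmetricForms k n 4 ≤ Submodule.span k (Set.range (quarticProducts k n)) := by
  refine (symmetricForms_le_span_psum k n 4).trans (Submodule.span_mono ?_)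
  rintro _ ⟨l, hl, hp, hsum, rfl⟩
  rcases l with _ | ⟨a, _ | ⟨b, _ | ⟨c, _ | ⟨d, _ | ⟨e, l⟩⟩⟩⟩⟩ <;>
    simp only [List.mem_cons, forall_eq_or_imp, List.not_mem_nil, List.sum_cons, List.sum_nil,
      List.pairwise_cons, IsEmpty.forall_iff, implies_true, and_true] at hl hp hsum
  · omega
  · obtain rfl : a = 4 := by omega
    exact ⟨0, by simp [quarticProducts]⟩
  · obtain ⟨rfl, rfl⟩ | ⟨rfl, rfl⟩ : (a = 3 ∧ b = 1) ∨ (a = 2 ∧ b = 2) := by omega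
    · exact ⟨1, by simp [quarticProducts]⟩
    · exact ⟨2, by simp [quarticProducts, -mul_eq_mul_left_iff]; ring⟩
  · obtain ⟨rfl, rfl, rfl⟩ : a = 2 ∧ b = 1 ∧ c = 1 := by omega
    exact ⟨3, by simp [quarticProducts, -mul_eq_mul_left_iff]; ring⟩
  · obtain ⟨rfl, rfl, rfl, rfl⟩ : a = 1 ∧ b = 1 ∧ c = 1 ∧ d = 1 := by omega
    exact ⟨4, by simp [quarticProducts, -mul_eq_mul_left_iff]; ring⟩
  · omega

theorem symmetricForms_five_le_span [CharZero k] :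
    symmetricForms k n 5 ≤ Submodule.span k (Set.range (quinticProducts k n)) := by
  refine (symmetricForms_le_span_psum k n 5).trans (Submodule.span_mono ?_)
  rintro _ ⟨l, hl, hp, hsum, rfl⟩
  rcases l with _ | ⟨a, _ | ⟨b, _ | ⟨c, _ | ⟨d, _ | ⟨e, _ | ⟨f, l⟩⟩⟩⟩⟩⟩ <;>
    simp only [List.mem_cons, forall_eq_or_imp, List.not_mem_nil, List.sum_cons, List.sum_nil,
      List.pairwise_cons, IsEmpty.forall_iff, implies_true, and_true] at hl hp hsum
  · omega
  · obtain rfl : a = 5 := by omega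
    exact ⟨0, by simp [quinticProducts]⟩
  · obtain ⟨rfl, rfl⟩ | ⟨rfl, rfl⟩ : (a = 4 ∧ b = 1) ∨ (a = 3 ∧ b = 2) := by omega
    · exact ⟨1, by simp [quinticProducts]⟩
    · exact ⟨2, by simp [quinticProducts]⟩
  · obtain ⟨rfl, rfl, rfl⟩ | ⟨rfl, rfl, rfl⟩ :
      (a = 3 ∧ b = 1 ∧ c = 1) ∨ (a = 2 ∧ b = 2 ∧ c = 1) := by omega
    · exact ⟨3, by simp [quinticProducts, -mul_eq_mul_left_iff]; ring⟩
    · exact ⟨4, by simp [quinticProducts, -mul_eq_mul_left_iff]; ring⟩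
  · obtain ⟨rfl, rfl, rfl, rfl⟩ : a = 2 ∧ b = 1 ∧ c = 1 ∧ d = 1 := by omega
    exact ⟨5, by simp [quinticProducts, -mul_eq_mul_left_iff]; ring⟩
  · obtain ⟨rfl, rfl, rfl, rfl, rfl⟩ : a = 1 ∧ b = 1 ∧ c = 1 ∧ d = 1 ∧ e = 1 := by omega
    exact ⟨6, by simp [quinticProducts, -mul_eq_mul_left_iff]; ring⟩
  · omega

end PowerSums

/-! ### From coordinates to generic forms, and from generic to dense. -/

section Genericity

theorem HoldsGenerically.mono {k : Type*} [Field k] {n : ℕ}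
    {V : Submodule k (MvPolynomial (Fin n) k)} {P Q : MvPolynomial (Fin n) k → Prop}
    (h : HoldsGenerically V P) (hPQ : ∀ F, P F → Q F) : HoldsGenerically V Q := by
  obtain ⟨g, hg, hP⟩ := h
  exact ⟨g, hg, fun F hF hgF => hPQ F (hP F hF hgF)⟩

theorem evalCoeffs_aeval {k : Type*} [Field k] {n : ℕ} {ι : Type*}
    (f : ι → MvPolynomial (Fin n →₀ ℕ) k) (h : MvPolynomial ι k) (F : MvPolynomial (Fin n) k) :
    evalCoeffs (aeval f h) F = eval (fun j => evalCoeffs (f j) F) h := by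
  induction h using MvPolynomial.induction_on with
  | C a => simp [evalCoeffs]
  | add p q hp hq => simp_all [evalCoeffs]
  | mul_X p i hp => simp_all [evalCoeffs]

/-- On forms of degree `d`, every linear functional is a linear polynomial in the coefficients. -/
theorem exists_evalCoeffs_eq_of_isHomogeneous {k : Type*} [Field k] {n : ℕ} (d : ℕ)
    (φ : MvPolynomial (Fin n) k →ₗ[k] k) :
    ∃ g : MvPolynomial (Fin n →₀ ℕ) k,
      ∀ F : MvPolynomial (Fin n) k, F.IsHomogeneous d → evalCoeffs g F = φ F := by
  classical
  refine ⟨∑ m ∈ Finset.univ.finsuppAntidiag d, C (φ (monomial m 1)) * X m, fun F hF => ?_⟩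
  have hsub : F.support ⊆ Finset.univ.finsuppAntidiag d := fun m hm => by
    have := hF (mem_support_iff.1 hm)
    rw [Finset.mem_finsuppAntidiag]
    refine ⟨?_, Finset.subset_univ _⟩
    rw [← this, Finsupp.weight_apply, Finsupp.sum_fintype _ _ (by simp)]
    simp
  conv_rhs => rw [F.as_sum, map_sum]
  rw [Finset.sum_subset hsub fun m _ hm => by
    rw [notMem_support_iff.1 hm, monomial_zero, map_zero]]
  simp only [evalCoeffs, map_sum, map_mul, eval_C, eval_X]
  refine Finset.sum_congr rfl fun m _ => ?_
  rw [mul_comm, ← smul_eq_mul, ← map_smul, smul_monomial, smul_eq_mul, mul_one]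

/-- If the coordinates of a family with respect to a spanning family of forms attain all values
outside a hypersurface, then the generic form is a member of the family. -/
theorem holdsGenerically_exists_eq {k : Type*} [Field k] {n d N : ℕ}
    {V : Submodule k (MvPolynomial (Fin n) k)} (hV : V ≤ homogeneousSubmodule (Fin n) k d)
    {b : Fin N → MvPolynomial (Fin n) k} (hb : ∀ j, b j ∈ V)
    (hspan : V ≤ Submodule.span k (Set.range b))
    {Φ : (Fin N → k) → MvPolynomial (Fin n) k} {c : Fin N → MvPolynomial (Fin N) k}
    (hc : AreCoordinates Φ b c) (h : MvPolynomial (Fin N) k) {t₀ : Fin N → k}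
    (ht₀ : eval t₀ h ≠ 0)
    (hsurj : ∀ t, eval t h ≠ 0 → ∃ α, ∀ j, eval α (c j) = t j) :
    HoldsGenerically V fun F => ∃ α, F = Φ α := by
  set π := Fintype.linearCombination k b with hπ
  have hπV (t) : π t ∈ V := by
    rw [hπ, Fintype.linearCombination_apply]
    exact sum_mem fun j _ => V.smul_mem _ (hb j)
  -- The forms `b j` may be dependent, so coordinates are not unique; `σ` chooses them linearly.
  obtain ⟨s, hs⟩ := LinearMap.exists_rightInverse_of_surjective π.rangeRestrict
    π.range_rangeRestrict
  obtain ⟨σ, hσ⟩ := LinearMap.exists_extend s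
  have hσπ (F) (hF : F ∈ V) : π (σ F) = F := by
    have hr : F ∈ LinearMap.range π := by
      rw [hπ, Fintype.range_linearCombination]
      exact hspan hF
    have h1 : σ F = s ⟨F, hr⟩ := LinearMap.congr_fun hσ ⟨F, hr⟩
    have h2 := congrArg Subtype.val (LinearMap.congr_fun hs ⟨F, hr⟩)
    rw [h1]
    exact h2
  choose g hg using fun j => exists_evalCoeffs_eq_of_isHomogeneous d (LinearMap.proj j ∘ₗ σ)
  -- The image of `σ` could lie inside the hypersurface `h = 0`. Translating by `u`, which `π`
  -- kills, makes it pass through `t₀` without changing the forms represented.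
  set u := t₀ - σ (π t₀) with hu
  have hG (F) (hF : F ∈ V) :
      evalCoeffs (aeval (fun j => g j + C (u j)) h) F = eval (σ F + u) h := by
    rw [evalCoeffs_aeval]
    congr 2
    funext j
    simpa [evalCoeffs] using hg j F (hV hF)
  refine ⟨aeval (fun j => g j + C (u j)) h, ⟨π t₀, hπV _, ?_⟩, fun F hF hne => ?_⟩
  · rw [hG _ (hπV _), hu, add_sub_cancel]
    exact ht₀
  · rw [hG _ hF] at hne
    obtain ⟨α, hα⟩ := hsurj _ hne
    refine ⟨α, ?_⟩
    have h1 : Φ α = π (σ F + u) := by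
      rw [hc α, hπ, Fintype.linearCombination_apply]
      exact Finset.sum_congr rfl fun j _ => by rw [hα j, smul_eq_C_mul]
    rw [h1, map_add, hσπ F hF, hu, map_sub, hσπ _ (hπV _), sub_self, add_zero]

/-- A family of forms in `V` that contains the generic element of `V` is dominant. -/
theorem isDominantInto_of_holdsGenerically {k : Type*} [Field k] [Infinite k] {n : ℕ}
    {V : Submodule k (MvPolynomial (Fin n) k)} {A : Type*} {Φ : A → MvPolynomial (Fin n) k}
    (hΦ : ∀ a, Φ a ∈ V) (h : HoldsGenerically V fun F => ∃ a, F = Φ a) :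
    IsDominantInto V Φ := by
  refine ⟨hΦ, fun g hg F hF => ?_⟩
  obtain ⟨f, ⟨G, hG, hfG⟩, hf⟩ := h
  -- Restriction to the line through `F` (at `s = 0`) and `G` (at `s = 1`): there `f * g` vanishes
  -- identically, and `k[s]` is a domain.
  have key (q : MvPolynomial (Fin n →₀ ℕ) k) (s : k) :
      (aeval (fun m => Polynomial.C (coeff m F) + Polynomial.X * Polynomial.C (coeff m (G - F)))
        q).eval s = evalCoeffs q (F + s • (G - F)) := by
    induction q using MvPolynomial.induction_on with
    | C a => simp [evalCoeffs]
    | add p q hp hq => simp_all [evalCoeffs]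
    | mul_X p i hp => simp_all [evalCoeffs]
  set l : (Fin n →₀ ℕ) → Polynomial k :=
    fun m => Polynomial.C (coeff m F) + Polynomial.X * Polynomial.C (coeff m (G - F))
  have h0 : aeval l f * aeval l g = 0 := by
    refine Polynomial.funext fun s => ?_
    rw [Polynomial.eval_mul, key, key, Polynomial.eval_zero, mul_eq_zero, or_iff_not_imp_left]
    intro hne
    obtain ⟨a, ha⟩ := hf _ (V.add_mem hF (V.smul_mem s (V.sub_mem hG hF))) hne
    rw [ha, hg]
  rcases mul_eq_zero.1 h0 with h0 | h0
  · refine absurd ?_ hfG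
    have := key f 1
    rwa [h0, Polynomial.eval_zero, one_smul, add_sub_cancel, eq_comm] at this
  · have := key g 0
    rwa [h0, Polynomial.eval_zero, zero_smul, add_zero, eq_comm] at this

end Genericity

/-! ### Expansion of the sums of powers in power sums. -/

section PairSums

theorem two_mul_sum_sum_Ioi {R : Type*} [CommRing R] {n : ℕ} (f : Fin n → Fin n → R)
    (hf : ∀ i j, f i j = f j i) :
    2 * ∑ i, ∑ j ∈ Finset.Ioi i, f i j = ∑ i, ∑ j, f i j - ∑ i, f i i := by
  have h1 (i : Fin n) : ∑ j, f i j =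
      ∑ j ∈ Finset.Iio i, f i j + f i i + ∑ j ∈ Finset.Ioi i, f i j := by
    rw [← Finset.sum_filter_add_sum_filter_not Finset.univ (fun j => j ≤ i)]
    congr 1
    · rw [add_comm, ← Finset.sum_insert (s := Finset.Iio i) (by simp), Finset.Iio_insert]
      refine Finset.sum_congr ?_ fun _ _ => rfl
      ext j
      simp
    · refine Finset.sum_congr ?_ fun _ _ => rfl
      ext j
      simp
  have h2 : ∑ i, ∑ j ∈ Finset.Iio i, f i j = ∑ i, ∑ j ∈ Finset.Ioi i, f i j := by
    rw [Finset.sum_comm' (t' := Finset.univ) (s' := fun j => Finset.Ioi j) (by simp)]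
    exact Finset.sum_congr rfl fun i _ => Finset.sum_congr rfl fun j _ => hf _ _
  simp only [h1, Finset.sum_add_distrib, h2]
  ring

variable {R : Type*} [CommRing R] {n : ℕ} (x : Fin n → R) (a b : R)

theorem sum_mul_sum_add_mul_pow_four :
    ∑ i, (a * ∑ i, x i + b * x i) ^ 4 =
      b ^ 4 * ∑ i, x i ^ 4 + 4 * a * b ^ 3 * ((∑ i, x i ^ 3) * ∑ i, x i) +
      6 * a ^ 2 * b ^ 2 * ((∑ i, x i ^ 2) * (∑ i, x i) ^ 2) +
      (n * a ^ 4 + 4 * a ^ 3 * b) * (∑ i, x i) ^ 4 := by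
  set p := ∑ i, x i with hp
  have h (i) : (a * p + b * x i) ^ 4 = b ^ 4 * x i ^ 4 + 4 * a * b ^ 3 * p * x i ^ 3 +
      6 * a ^ 2 * b ^ 2 * p ^ 2 * x i ^ 2 + 4 * a ^ 3 * b * p ^ 3 * x i + a ^ 4 * p ^ 4 := by ring
  simp only [h, Finset.sum_add_distrib, ← Finset.mul_sum, ← hp, Finset.sum_const, Finset.card_univ,
    Fintype.card_fin, nsmul_eq_mul]
  ring

theorem sum_mul_sum_add_mul_pow_five :
    ∑ i, (a * ∑ i, x i + b * x i) ^ 5 =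
      b ^ 5 * ∑ i, x i ^ 5 + 5 * a * b ^ 4 * ((∑ i, x i ^ 4) * ∑ i, x i) +
      10 * a ^ 2 * b ^ 3 * ((∑ i, x i ^ 3) * (∑ i, x i) ^ 2) +
      10 * a ^ 3 * b ^ 2 * ((∑ i, x i ^ 2) * (∑ i, x i) ^ 3) +
      (n * a ^ 5 + 5 * a ^ 4 * b) * (∑ i, x i) ^ 5 := by
  set p := ∑ i, x i with hp
  have h (i) : (a * p + b * x i) ^ 5 = b ^ 5 * x i ^ 5 + 5 * a * b ^ 4 * p * x i ^ 4 +
      10 * a ^ 2 * b ^ 3 * p ^ 2 * x i ^ 3 + 10 * a ^ 3 * b ^ 2 * p ^ 3 * x i ^ 2 +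
      5 * a ^ 4 * b * p ^ 4 * x i + a ^ 5 * p ^ 5 := by ring
  simp only [h, Finset.sum_add_distrib, ← Finset.mul_sum, ← hp, Finset.sum_const, Finset.card_univ,
    Fintype.card_fin, nsmul_eq_mul]
  ring

/-- Doubling keeps the identity valid in every commutative ring: the term `n(n-1)/2 * a ^ 4` needs
no division. -/
theorem two_mul_sum_pairs_pow_four :
    2 * ∑ i, ∑ j ∈ Finset.Ioi i, (a * ∑ i, x i + b * x i + b * x j) ^ 4 =
      2 * ((n - 8) * b ^ 4 * ∑ i, x i ^ 4 +
      (4 * (n - 4) * a * b ^ 3 + 4 * b ^ 4) * ((∑ i, x i ^ 3) * ∑ i, x i) +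
      3 * b ^ 4 * (∑ i, x i ^ 2) ^ 2 +
      (6 * (n - 2) * a ^ 2 * b ^ 2 + 12 * a * b ^ 3) * ((∑ i, x i ^ 2) * (∑ i, x i) ^ 2) +
      (4 * (n - 1) * a ^ 3 * b + 6 * a ^ 2 * b ^ 2) * (∑ i, x i) ^ 4) +
      n * (n - 1) * a ^ 4 * (∑ i, x i) ^ 4 := by
  rw [two_mul_sum_sum_Ioi _ fun i j => by ring]
  set p := ∑ i, x i with hp
  have h (i j) : (a * p + b * x i + b * x j) ^ 4 =
      (a * p + b * x i) ^ 4 + 4 * b * (a * p + b * x i) ^ 3 * x j +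
      6 * b ^ 2 * (a * p + b * x i) ^ 2 * x j ^ 2 +
      4 * b ^ 3 * (a * p + b * x i) * x j ^ 3 + b ^ 4 * x j ^ 4 := by ring
  have h' (i) : ∑ j, (a * p + b * x i + b * x j) ^ 4 - (a * p + b * x i + b * x i) ^ 4 =
      (n * b ^ 4 - 16 * b ^ 4) * x i ^ 4 +
      (4 * n * a * b ^ 3 * p + 4 * b ^ 4 * p - 32 * a * b ^ 3 * p) * x i ^ 3 +
      (6 * n * a ^ 2 * b ^ 2 * p ^ 2 + 12 * a * b ^ 3 * p * p + 6 * b ^ 4 * ∑ j, x j ^ 2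
        - 24 * a ^ 2 * b ^ 2 * p ^ 2) * x i ^ 2 +
      (4 * n * a ^ 3 * b * p ^ 3 + 12 * a ^ 2 * b ^ 2 * p ^ 3 + 12 * a * b ^ 3 * p * ∑ j, x j ^ 2 +
        4 * b ^ 4 * ∑ j, x j ^ 3 - 8 * a ^ 3 * b * p ^ 3) * x i +
      (n * a ^ 4 * p ^ 4 + 4 * a ^ 3 * b * p ^ 4 + 6 * a ^ 2 * b ^ 2 * p ^ 2 * ∑ j, x j ^ 2 +
        4 * a * b ^ 3 * p * ∑ j, x j ^ 3 + b ^ 4 * ∑ j, x j ^ 4 - a ^ 4 * p ^ 4) := by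
    simp only [h, Finset.sum_add_distrib, ← Finset.mul_sum, ← hp, Finset.sum_const,
      Finset.card_univ, Fintype.card_fin, nsmul_eq_mul]
    ring
  rw [← Finset.sum_sub_distrib]
  simp only [h', Finset.sum_add_distrib, ← Finset.mul_sum, ← hp, Finset.sum_const,
    Finset.card_univ, Fintype.card_fin, nsmul_eq_mul]
  ring

theorem two_mul_sum_pairs_pow_five :
    2 * ∑ i, ∑ j ∈ Finset.Ioi i, (a * ∑ i, x i + b * x i + b * x j) ^ 5 =
      2 * ((n - 16) * b ^ 5 * ∑ i, x i ^ 5 +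
      (5 * (n - 8) * a * b ^ 4 + 5 * b ^ 5) * ((∑ i, x i ^ 4) * ∑ i, x i) +
      10 * b ^ 5 * ((∑ i, x i ^ 3) * ∑ i, x i ^ 2) +
      (10 * (n - 4) * a ^ 2 * b ^ 3 + 20 * a * b ^ 4) * ((∑ i, x i ^ 3) * (∑ i, x i) ^ 2) +
      15 * a * b ^ 4 * ((∑ i, x i ^ 2) ^ 2 * ∑ i, x i) +
      (10 * (n - 2) * a ^ 3 * b ^ 2 + 30 * a ^ 2 * b ^ 3) * ((∑ i, x i ^ 2) * (∑ i, x i) ^ 3) +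
      (5 * (n - 1) * a ^ 4 * b + 10 * a ^ 3 * b ^ 2) * (∑ i, x i) ^ 5) +
      n * (n - 1) * a ^ 5 * (∑ i, x i) ^ 5 := by
  rw [two_mul_sum_sum_Ioi _ fun i j => by ring]
  set p := ∑ i, x i with hp
  have h (i j) : (a * p + b * x i + b * x j) ^ 5 =
      (a * p + b * x i) ^ 5 + 5 * b * (a * p + b * x i) ^ 4 * x j +
      10 * b ^ 2 * (a * p + b * x i) ^ 3 * x j ^ 2 +
      10 * b ^ 3 * (a * p + b * x i) ^ 2 * x j ^ 3 +
      5 * b ^ 4 * (a * p + b * x i) * x j ^ 4 + b ^ 5 * x j ^ 5 := by ring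
  have h' (i) : ∑ j, (a * p + b * x i + b * x j) ^ 5 - (a * p + b * x i + b * x i) ^ 5 =
      (n * b ^ 5 - 32 * b ^ 5) * x i ^ 5 +
      (5 * n * a * b ^ 4 * p + 5 * b ^ 5 * p - 80 * a * b ^ 4 * p) * x i ^ 4 +
      (10 * n * a ^ 2 * b ^ 3 * p ^ 2 + 20 * a * b ^ 4 * p ^ 2 + 10 * b ^ 5 * ∑ j, x j ^ 2
        - 80 * a ^ 2 * b ^ 3 * p ^ 2) * x i ^ 3 +
      (10 * n * a ^ 3 * b ^ 2 * p ^ 3 + 30 * a ^ 2 * b ^ 3 * p ^ 3 +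
        30 * a * b ^ 4 * p * ∑ j, x j ^ 2 + 10 * b ^ 5 * ∑ j, x j ^ 3
        - 40 * a ^ 3 * b ^ 2 * p ^ 3) * x i ^ 2 +
      (5 * n * a ^ 4 * b * p ^ 4 + 20 * a ^ 3 * b ^ 2 * p ^ 4 +
        30 * a ^ 2 * b ^ 3 * p ^ 2 * ∑ j, x j ^ 2 + 20 * a * b ^ 4 * p * ∑ j, x j ^ 3 +
        5 * b ^ 5 * ∑ j, x j ^ 4 - 10 * a ^ 4 * b * p ^ 4) * x i +
      (n * a ^ 5 * p ^ 5 + 5 * a ^ 4 * b * p ^ 5 + 10 * a ^ 3 * b ^ 2 * p ^ 3 * ∑ j, x j ^ 2 +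
        10 * a ^ 2 * b ^ 3 * p ^ 2 * ∑ j, x j ^ 3 + 5 * a * b ^ 4 * p * ∑ j, x j ^ 4 +
        b ^ 5 * ∑ j, x j ^ 5 - a ^ 5 * p ^ 5) := by
    simp only [h, Finset.sum_add_distrib, ← Finset.mul_sum, ← hp, Finset.sum_const,
      Finset.card_univ, Fintype.card_fin, nsmul_eq_mul]
    ring
  rw [← Finset.sum_sub_distrib]
  simp only [h', Finset.sum_add_distrib, ← Finset.mul_sum, ← hp, Finset.sum_const,
    Finset.card_univ, Fintype.card_fin, nsmul_eq_mul]
  ring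

end PairSums

/-! ### Coordinates of the two families. -/

section Coordinates

variable (k : Type*) [Field k] (n : ℕ)

/-- The coordinates of `quarticFamily n` with respect to `quarticProducts k n`. -/
noncomputable def quarticCoords : Fin 5 → MvPolynomial (Fin 5) k :=
  ![X 2 ^ 4 + C (n - 8 : k) * X 4 ^ 4,
    4 * X 1 * X 2 ^ 3 + C (4 * (n - 4) : k) * X 3 * X 4 ^ 3 + 4 * X 4 ^ 4,
    3 * X 4 ^ 4,
    6 * X 1 ^ 2 * X 2 ^ 2 + C (6 * (n - 2) : k) * X 3 ^ 2 * X 4 ^ 2 + 12 * X 3 * X 4 ^ 3,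
    X 0 ^ 4 + C (n : k) * X 1 ^ 4 + 4 * X 1 ^ 3 * X 2 + C (n * (n - 1) / 2 : k) * X 3 ^ 4 +
      C (4 * (n - 1) : k) * X 3 ^ 3 * X 4 + 6 * X 3 ^ 2 * X 4 ^ 2]

/-- The coordinates of `quinticFamily n` with respect to `quinticProducts k n`. -/
noncomputable def quinticCoords : Fin 7 → MvPolynomial (Fin 7) k :=
  ![X 2 ^ 5 + C (n - 16 : k) * X 4 ^ 5 + X 6 ^ 5,
    5 * X 1 * X 2 ^ 4 + C (5 * (n - 8) : k) * X 3 * X 4 ^ 4 + 5 * X 4 ^ 5 + 5 * X 5 * X 6 ^ 4,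
    10 * X 4 ^ 5,
    10 * X 1 ^ 2 * X 2 ^ 3 + C (10 * (n - 4) : k) * X 3 ^ 2 * X 4 ^ 3 + 20 * X 3 * X 4 ^ 4 +
      10 * X 5 ^ 2 * X 6 ^ 3,
    15 * X 3 * X 4 ^ 4,
    10 * X 1 ^ 3 * X 2 ^ 2 + C (10 * (n - 2) : k) * X 3 ^ 3 * X 4 ^ 2 + 30 * X 3 ^ 2 * X 4 ^ 3 +
      10 * X 5 ^ 3 * X 6 ^ 2,
    X 0 ^ 5 + C (n : k) * X 1 ^ 5 + 5 * X 1 ^ 4 * X 2 + C (n * (n - 1) / 2 : k) * X 3 ^ 5 +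
      C (5 * (n - 1) : k) * X 3 ^ 4 * X 4 + 10 * X 3 ^ 3 * X 4 ^ 2 + C (n : k) * X 5 ^ 5 + 5 * X 5 ^ 4 * X 6]

theorem areCoordinates_quarticCoords [CharZero k] :
    AreCoordinates (quarticFamily n) (quarticProducts k n) (quarticCoords k n) := by
  intro α
  have h2 : (2 * C (n * (n - 1) / 2 : k) : MvPolynomial (Fin n) k) = n * (n - 1) := by
    rw [← map_ofNat (C : k →+* MvPolynomial (Fin n) k) 2, ← C_mul, mul_div_cancel₀ _ two_ne_zero]
    simp
  refine mul_left_cancel₀ (two_ne_zero' (MvPolynomial (Fin n) k)) ?_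
  rw [quarticFamily, mul_add, mul_add, sumVars, sum_mul_sum_add_mul_pow_four,
    two_mul_sum_pairs_pow_four]
  simp only [Fin.sum_univ_five, quarticProducts, quarticCoords, psum, pow_one, Matrix.cons_val,
    map_add, map_sub, map_mul, map_pow, map_natCast, map_ofNat, eval_X, eval_C, map_one]
  linear_combination (-C (α 3) ^ 4 * (∑ i, X i) ^ 4) * h2

theorem areCoordinates_quinticCoords [CharZero k] :
    AreCoordinates (quinticFamily n) (quinticProducts k n) (quinticCoords k n) := by
  intro α
  have h2 : (2 * C (n * (n - 1) / 2 : k) : MvPolynomial (Fin n) k) = n * (n - 1) := by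
    rw [← map_ofNat (C : k →+* MvPolynomial (Fin n) k) 2, ← C_mul, mul_div_cancel₀ _ two_ne_zero]
    simp
  refine mul_left_cancel₀ (two_ne_zero' (MvPolynomial (Fin n) k)) ?_
  rw [quinticFamily, mul_add, mul_add, mul_add, sumVars, sum_mul_sum_add_mul_pow_five,
    sum_mul_sum_add_mul_pow_five, two_mul_sum_pairs_pow_five]
  simp only [Fin.sum_univ_seven, quinticProducts, quinticCoords, psum, pow_one, Matrix.cons_val,
    map_add, map_sub, map_mul, map_pow, map_natCast, map_ofNat, eval_X, eval_C, map_one]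
  linear_combination (-C (α 3) ^ 5 * (∑ i, X i) ^ 5) * h2

end Coordinates

/-! ### Nonvanishing of the Jacobian determinants. -/

section Jacobian

theorem pderiv_ofNat {k ι : Type*} [CommSemiring k] (i : ι) (m : ℕ) [m.AtLeastTwo] :
    pderiv i (ofNat(m) : MvPolynomial ι k) = 0 :=
  (pderiv i).map_natCast m

theorem jacobianDet_ne_zero {k : Type*} [Field k] {N : ℕ} {c : Fin N → MvPolynomial (Fin N) k}
    (a : Fin N → k)
    (h : ∀ v : Fin N → k, (∀ i, ∑ j, eval a (pderiv i (c j)) * v j = 0) → v = 0) :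
    jacobianDet c ≠ 0 := by
  intro h0
  have h1 := congrArg (eval a) h0
  rw [jacobianDet, RingHom.map_det, map_zero, ← Matrix.exists_mulVec_eq_zero_iff] at h1
  obtain ⟨v, hv, hv0⟩ := h1
  refine hv (h v fun i => ?_)
  simpa [Matrix.mulVec, dotProduct] using congrFun hv0 i

variable (k : Type*) [Field k] [CharZero k] (n : ℕ)

theorem jacobianDet_quarticCoords_ne_zero : jacobianDet (quarticCoords k n) ≠ 0 := by
  -- With `α₁ = α₃ = 0` most partial derivatives vanish and the linear system becomes triangular.
  refine jacobianDet_ne_zero ![1, 0, 1, 0, 1] fun v hv => ?_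
  have h0 := hv 0
  have h1 := hv 1
  have h2 := hv 2
  have h3 := hv 3
  have h4 := hv 4
  simp [quarticCoords, Fin.sum_univ_five, pderiv_X, Derivation.leibniz_pow, pderiv_ofNat]
    at h0 h1 h2 h3 h4
  simp only [h1, h2, mul_zero, zero_add, add_zero, mul_eq_zero, OfNat.ofNat_ne_zero,
    false_or] at h3 h4
  ext i
  fin_cases i <;> simp [*]

theorem jacobianDet_quinticCoords_ne_zero : jacobianDet (quinticCoords k n) ≠ 0 := by
  -- The ratios `α₁/α₂ = 0` and `α₅/α₆ = 1` are the two nodes of the moment problem; they must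
  -- differ for the matrix to be invertible.
  refine jacobianDet_ne_zero ![1, 0, 1, 0, 1, 1, 1] fun v hv => ?_
  have h0 := hv 0
  have h1 := hv 1
  have h2 := hv 2
  have h3 := hv 3
  have h4 := hv 4
  have h5 := hv 5
  have h6 := hv 6
  simp [quinticCoords, Fin.sum_univ_seven, pderiv_X, Derivation.leibniz_pow, pderiv_ofNat]
    at h0 h1 h2 h3 h4 h5 h6
  simp only [h0, h1, h2, mul_zero, zero_add, add_zero] at h3 h4 h5 h6
  have e3 : v 3 = 0 := by linear_combination (3 / 50) * h6 - (1 / 25) * h5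
  have e5 : v 5 = 0 := by linear_combination (3 / 50) * h5 - (1 / 25) * h6
  have e4 : v 4 = 0 := by linear_combination (1 / 15) * h3 - (4 / 3) * e3
  have e2 : v 2 = 0 := by linear_combination (1 / 50) * h4
  ext i
  fin_cases i <;> simp [*]

end Jacobian

/-! ### Counting summands. -/

section WaringRank

variable {k : Type*} [Field k] {n : ℕ}

theorem IsPowerSum.add {d r s : ℕ} {F G : MvPolynomial (Fin n) k} (hF : IsPowerSum d r F)
    (hG : IsPowerSum d s G) : IsPowerSum d (r + s) (F + G) := by
  obtain ⟨L, hL, rfl⟩ := hF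
  obtain ⟨M, hM, rfl⟩ := hG
  refine ⟨Fin.append L M, fun i => ?_, by simp [Fin.sum_univ_add]⟩
  refine Fin.addCases (fun i => ?_) (fun i => ?_) i
  · simpa using hL i
  · simpa using hM i

theorem isPowerSum_sum {ι : Type*} (s : Finset ι) {d : ℕ} {L : ι → MvPolynomial (Fin n) k}
    (hL : ∀ i ∈ s, (L i).IsHomogeneous 1) : IsPowerSum d s.card (∑ i ∈ s, L i ^ d) := by
  refine ⟨fun i => L (s.equivFin.symm i), fun i => hL _ (s.equivFin.symm i).2, ?_⟩
  rw [← Finset.sum_coe_sort, s.equivFin.symm.sum_comp fun i : s => L i ^ d]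

theorem isPowerSum_pow {d : ℕ} {L : MvPolynomial (Fin n) k} (hL : L.IsHomogeneous 1) :
    IsPowerSum d 1 (L ^ d) :=
  ⟨fun _ => L, fun _ => hL, by simp⟩

theorem isPowerSum_sum_pairs {d : ℕ} {L : Fin n → Fin n → MvPolynomial (Fin n) k}
    (hL : ∀ i j, (L i j).IsHomogeneous 1) :
    IsPowerSum d (n.choose 2) (∑ i, ∑ j ∈ Finset.Ioi i, L i j ^ d) := by
  rw [Finset.sum_sigma']
  convert isPowerSum_sum (L := fun p : (_ : Fin n) × Fin n => L p.1 p.2) _ fun p _ => hL _ _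
  -- The pairs `i < j` number `∑ (n - 1 - i)`, a reversed sum of `0, …, n - 1`.
  rw [Finset.card_sigma, Finset.sum_congr rfl fun i _ => Fin.card_Ioi i,
    Fin.sum_univ_eq_sum_range fun i => n - 1 - i, Finset.sum_range_reflect (fun i => i),
    Finset.sum_range_id, Nat.choose_two_right]

theorem IsPowerSum.waringRank_le {d r : ℕ} {F : MvPolynomial (Fin n) k} (h : IsPowerSum d r F) :
    waringRank d F ≤ (r : ℕ∞) :=
  sInf_le ⟨r, rfl, h⟩

theorem isHomogeneous_C_mul_sumVars (a : k) : (C a * sumVars k n).IsHomogeneous 1 :=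
  (IsHomogeneous.sum _ _ _ fun i _ => isHomogeneous_X k i).C_mul a

theorem isHomogeneous_C_mul_X (a : k) (i : Fin n) :
    (C a * X i : MvPolynomial (Fin n) k).IsHomogeneous 1 :=
  (isHomogeneous_X k i).C_mul a

theorem waringRank_quarticFamily_le (α : Fin 5 → k) :
    waringRank 4 (quarticFamily n α) ≤ (((n + 1).choose 2 + 1 : ℕ) : ℕ∞) := by
  have h := isHomogeneous_C_mul_sumVars (k := k) (n := n)
  have hX := isHomogeneous_C_mul_X (k := k) (n := n)
  have key := ((isPowerSum_pow (d := 4) (h (α 0))).add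
    (isPowerSum_sum Finset.univ (d := 4) fun i _ => (h (α 1)).add (hX (α 2) i))).add
    (isPowerSum_sum_pairs (d := 4) fun i j => ((h (α 3)).add (hX (α 4) i)).add (hX (α 4) j))
  convert key.waringRank_le using 2
  · rfl
  rw [Finset.card_fin, Nat.choose_succ_succ' n 1, Nat.choose_one_right]
  ring

theorem waringRank_quinticFamily_le (α : Fin 7 → k) :
    waringRank 5 (quinticFamily n α) ≤ (((n + 2).choose 2 : ℕ) : ℕ∞) := by
  have h := isHomogeneous_C_mul_sumVars (k := k) (n := n)
  have hX := isHomogeneous_C_mul_X (k := k) (n := n)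
  have key := (((isPowerSum_pow (d := 5) (h (α 0))).add
    (isPowerSum_sum Finset.univ (d := 5) fun i _ => (h (α 1)).add (hX (α 2) i))).add
    (isPowerSum_sum_pairs (d := 5) fun i j =>
      ((h (α 3)).add (hX (α 4) i)).add (hX (α 4) j))).add
    (isPowerSum_sum Finset.univ (d := 5) fun i _ => (h (α 5)).add (hX (α 6) i))
  convert key.waringRank_le using 2
  · rfl
  rw [Finset.card_fin, Nat.choose_succ_succ' (n + 1) 1, Nat.choose_succ_succ' n 1,
    Nat.choose_one_right, Nat.choose_one_right]
  ring

end WaringRank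

/-! ### Solving the coordinate equations off a hypersurface. -/

section Solving

variable (k : Type*) [Field k] (n : ℕ)

/-- A hypersurface in the space of coordinates of quartics outside of which every quartic belongs
to `quarticFamily`. -/
noncomputable def quarticDiscriminant : MvPolynomial (Fin 5) k :=
  X 2 * (3 * X 0 - C (n - 8 : k) * X 2) *
    (C ((n - 4) ^ 2 : k) * X 2 + C (n - 2 : k) * (3 * X 0 - C (n - 8 : k) * X 2))

theorem exists_eval_quarticDiscriminant_ne_zero [CharZero k] :
    ∃ t, eval t (quarticDiscriminant k n) ≠ 0 := by
  -- Chosen so that the first two factors are 1; the third is then `n² - 7n + 14`, which has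
  -- negative discriminant.
  refine ⟨![(n - 7) / 3, 0, 1, 0, 0], ?_⟩
  have h1 : (3 : k) * ((n - 7) / 3) - (n - 8) = 1 := by ring
  have h2 : ((n : k) - 4) ^ 2 + (n - 2) ≠ 0 := by
    have : ((n : ℤ) - 4) ^ 2 + (n - 2) ≠ 0 := by nlinarith [sq_nonneg (2 * (n : ℤ) - 7)]
    exact_mod_cast this
  simpa [quarticDiscriminant, h1] using h2

theorem exists_quarticCoords_eq [IsAlgClosed k] [CharZero k] (t : Fin 5 → k)
    (ht : eval t (quarticDiscriminant k n) ≠ 0) :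
    ∃ α, ∀ j, eval α (quarticCoords k n j) = t j := by
  have hdisc : eval t (quarticDiscriminant k n) = t 2 * (3 * t 0 - (n - 8) * t 2) *
      ((n - 4) ^ 2 * t 2 + (n - 2) * (3 * t 0 - (n - 8) * t 2)) := by
    simp [quarticDiscriminant]
  rw [hdisc, mul_ne_zero_iff, mul_ne_zero_iff] at ht
  obtain ⟨⟨h2, h0⟩, hq⟩ := ht
  obtain ⟨y, hy⟩ := IsAlgClosed.exists_pow_nat_eq (t 2 / 3) (n := 4) (by norm_num)
  obtain ⟨x, hx⟩ := IsAlgClosed.exists_pow_nat_eq (t 0 - (n - 8) * y ^ 4) (n := 4) (by norm_num)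
  have hy' : t 2 = 3 * y ^ 4 := by rw [hy]; ring
  have hx' : 3 * t 0 - (n - 8) * t 2 = 3 * x ^ 4 := by rw [hx, hy']; ring
  rw [hx'] at h0 hq
  rw [hy'] at h2 hq
  have hx0 : x ≠ 0 := by rintro rfl; simp at h0
  have hy0 : y ≠ 0 := by rintro rfl; simp at h2
  -- This is the leading coefficient of the quadratic in `z` obtained by multiplying the `p₂p₁²`
  -- equation by `x ^ 4` and eliminating `w * x ^ 3` with the `p₃p₁` equation.
  have hlead : 6 * y ^ 2 * ((n - 4) ^ 2 * y ^ 4 + (n - 2) * x ^ 4) ≠ 0 :=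
    mul_ne_zero (by simpa using hy0) fun h => hq (by linear_combination 3 * h)
  obtain ⟨z, hz⟩ := exists_quadratic_eq_zero
    (b := 12 * x ^ 4 * y ^ 3 - 12 * (t 1 / 4 - y ^ 4) * (n - 4) * y ^ 3)
    (c := 6 * (t 1 / 4 - y ^ 4) ^ 2 - t 3 * x ^ 4) hlead (IsAlgClosed.exists_eq_mul_self _)
  obtain ⟨w, hw⟩ : ∃ w, w * x ^ 3 = t 1 / 4 - y ^ 4 - (n - 4) * z * y ^ 3 :=
    ⟨_, div_mul_cancel₀ _ (pow_ne_zero 3 hx0)⟩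
  obtain ⟨s, hs⟩ := IsAlgClosed.exists_pow_nat_eq (t 4 - (n * w ^ 4 + 4 * w ^ 3 * x +
    n * (n - 1) / 2 * z ^ 4 + 4 * (n - 1) * z ^ 3 * y + 6 * z ^ 2 * y ^ 2)) (n := 4) (by norm_num)
  have h3 : 6 * w ^ 2 * x ^ 2 + 6 * (n - 2) * z ^ 2 * y ^ 2 + 12 * z * y ^ 3 = t 3 := by
    refine mul_right_cancel₀ (pow_ne_zero 4 hx0) ?_
    linear_combination hz + 6 * (w * x ^ 3 + (t 1 / 4 - y ^ 4 - (n - 4) * z * y ^ 3)) * hw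
  refine ⟨![s, w, x, z, y], fun j => ?_⟩
  fin_cases j <;> simp [quarticCoords]
  · linear_combination hx
  · linear_combination 4 * hw
  · linear_combination 3 * hy
  · linear_combination h3
  · linear_combination hs

/-- Four generic values are the moments of two points: by Sylvester, the generic binary
cubic is a sum of two cubes. -/
theorem exists_two_point_moments {k : Type*} [Field k] [IsAlgClosed k] [CharZero k]
    {s₀ s₁ s₂ s₃ : k} (hD : s₀ * s₂ - s₁ ^ 2 ≠ 0)
    (hdisc : (s₀ * s₃ - s₁ * s₂) ^ 2 - 4 * (s₀ * s₂ - s₁ ^ 2) * (s₁ * s₃ - s₂ ^ 2) ≠ 0) :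
    ∃ u v w₁ w₂ : k, w₁ + w₂ = s₀ ∧ u * w₁ + v * w₂ = s₁ ∧ u ^ 2 * w₁ + v ^ 2 * w₂ = s₂ ∧
      u ^ 3 * w₁ + v ^ 3 * w₂ = s₃ := by
  set D := s₀ * s₂ - s₁ ^ 2 with hDdef
  -- By Cramer's rule `e₁`, `e₂` solve the recurrence `s₍ₘ₊₂₎ = e₁ s₍ₘ₊₁₎ - e₂ sₘ`; the nodes are
  -- the roots of `T² - e₁ T + e₂`.
  obtain ⟨e₁, he₁⟩ : ∃ e, e * D = s₀ * s₃ - s₁ * s₂ := ⟨_, div_mul_cancel₀ _ hD⟩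
  obtain ⟨e₂, he₂⟩ : ∃ e, e * D = s₁ * s₃ - s₂ ^ 2 := ⟨_, div_mul_cancel₀ _ hD⟩
  obtain ⟨u, hu⟩ := exists_quadratic_eq_zero (a := 1) (b := -e₁) (c := e₂) one_ne_zero
    (IsAlgClosed.exists_eq_mul_self _)
  -- The expression in `hdisc` is `D² (e₁² - 4 e₂)`, so the two nodes are distinct and the weights
  -- can be solved for.
  have hne : e₁ - u - u ≠ 0 := by
    intro h
    refine hdisc ?_
    rw [← he₁, ← he₂]
    linear_combination D ^ 2 * (e₁ - 2 * u) * h - 4 * D ^ 2 * hu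
  have r₂ : e₁ * s₁ - e₂ * s₀ = s₂ := by
    refine mul_right_cancel₀ hD ?_
    linear_combination s₁ * he₁ - s₀ * he₂ - s₂ * hDdef
  have r₃ : e₁ * s₂ - e₂ * s₁ = s₃ := by
    refine mul_right_cancel₀ hD ?_
    linear_combination s₂ * he₁ - s₁ * he₂ - s₃ * hDdef
  obtain ⟨w, hw⟩ : ∃ w, w * (e₁ - u - u) = s₁ - u * s₀ := ⟨_, div_mul_cancel₀ _ hne⟩
  have m₁ : u * (s₀ - w) + (e₁ - u) * w = s₁ := by linear_combination hw
  have m₂ : u ^ 2 * (s₀ - w) + (e₁ - u) ^ 2 * w = s₂ := by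
    linear_combination r₂ + e₁ * m₁ + s₀ * hu
  refine ⟨u, e₁ - u, s₀ - w, w, by ring, m₁, m₂, ?_⟩
  linear_combination r₃ + e₁ * m₂ - e₂ * m₁ + (u * (s₀ - w) + (e₁ - u) * w) * hu

/-- A hypersurface in the space of coordinates of quintics outside of which every quintic belongs
to `quinticFamily`. -/
noncomputable def quinticDiscriminant : MvPolynomial (Fin 7) k :=
  let τ := C (1 / 10) * X 2
  let σ := C (1 / 15) * X 4
  let s₀ := X 0 - C (n - 16 : k) * τ
  let s₁ := C (1 / 5) * X 1 - C (n - 8 : k) * σ - τ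
  let s₂ := C (1 / 10) * τ * X 3 - C (n - 4 : k) * σ ^ 2 - 2 * σ * τ
  let s₃ := C (1 / 10) * τ ^ 2 * X 5 - C (n - 2 : k) * σ ^ 3 - 3 * σ ^ 2 * τ
  τ * (s₀ * s₂ - τ * s₁ ^ 2) *
    ((s₀ * s₃ - τ * s₁ * s₂) ^ 2 - 4 * τ * (s₀ * s₂ - τ * s₁ ^ 2) * (s₁ * s₃ - s₂ ^ 2))

theorem exists_eval_quinticDiscriminant_ne_zero [CharZero k] :
    ∃ t, eval t (quinticDiscriminant k n) ≠ 0 := by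
  -- Here `τ = 1`, `σ = 0` and the moments are `1, 0, 1, 0`, those of weights `1/2` at the nodes
  -- `±1`.
  refine ⟨![n - 15, 5, 10, 10, 0, 0, 0], ?_⟩
  have h1 : (n : k) - 15 - (n - 16) = 1 := by ring
  simp [quinticDiscriminant, h1]

/-- Once `y` and `z` are known, setting `α₁ = u a`, `α₂ = a`, `α₅ = v b`, `α₆ = b` turns four
equations into the moment equations for nodes `u`, `v` with weights `a⁵`, `b⁵`. -/
theorem exists_quinticCoords_eq [IsAlgClosed k] [CharZero k] (t : Fin 7 → k)
    (ht : eval t (quinticDiscriminant k n) ≠ 0) :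
    ∃ α, ∀ j, eval α (quinticCoords k n j) = t j := by
  obtain ⟨y, hy⟩ := IsAlgClosed.exists_pow_nat_eq (t 2 / 10) (n := 5) (by norm_num)
  have hτ : 1 / 10 * t 2 = y ^ 5 := by rw [hy]; ring
  have hy0 : y ≠ 0 := by
    rintro rfl
    refine ht ?_
    simp only [quinticDiscriminant, map_mul, eval_X, eval_C, hτ]
    ring
  obtain ⟨z, hz⟩ : ∃ z, z * y ^ 4 = (1 / 15) * t 4 := ⟨_, div_mul_cancel₀ _ (pow_ne_zero 4 hy0)⟩
  set s₀ := t 0 - (n - 16) * y ^ 5 with hs₀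
  set s₁ := t 1 / 5 - (n - 8) * (z * y ^ 4) - y ^ 5 with hs₁
  set s₂ := t 3 / 10 - (n - 4) * (z ^ 2 * y ^ 3) - 2 * (z * y ^ 4) with hs₂
  set s₃ := t 5 / 10 - (n - 2) * (z ^ 3 * y ^ 2) - 3 * (z ^ 2 * y ^ 3) with hs₃
  -- With `τ = y⁵` and `σ = z y⁴`, the last two moments in `quinticDiscriminant` are `τ s₂` and `τ²
  -- s₃`, scaled to be polynomial in `t`; altogether this contributes `τ⁶ = y³⁰`.
  have hdisc : eval t (quinticDiscriminant k n) = y ^ 30 * ((s₀ * s₂ - s₁ ^ 2) *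
      ((s₀ * s₃ - s₁ * s₂) ^ 2 - 4 * (s₀ * s₂ - s₁ ^ 2) * (s₁ * s₃ - s₂ ^ 2))) := by
    simp only [quinticDiscriminant, map_sub, map_mul, map_pow, map_ofNat, eval_X, eval_C,
      hτ, ← hz, hs₀, hs₁, hs₂, hs₃]
    ring
  rw [hdisc] at ht
  obtain ⟨hD, hd⟩ := mul_ne_zero_iff.1 (right_ne_zero_of_mul ht)
  obtain ⟨u, v, w₁, w₂, m₀, m₁, m₂, m₃⟩ := exists_two_point_moments hD hd
  obtain ⟨a, rfl⟩ := IsAlgClosed.exists_pow_nat_eq w₁ (n := 5) (by norm_num)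
  obtain ⟨b, rfl⟩ := IsAlgClosed.exists_pow_nat_eq w₂ (n := 5) (by norm_num)
  obtain ⟨s, hs⟩ := IsAlgClosed.exists_pow_nat_eq (t 6 - (n * (u * a) ^ 5 + 5 * (u * a) ^ 4 * a +
    n * (n - 1) / 2 * z ^ 5 + 5 * (n - 1) * z ^ 4 * y + 10 * z ^ 3 * y ^ 2 + n * (v * b) ^ 5 +
    5 * (v * b) ^ 4 * b)) (n := 5) (by norm_num)
  refine ⟨![s, u * a, a, z, y, v * b, b], fun j => ?_⟩
  fin_cases j <;> simp [quinticCoords]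
  · linear_combination m₀
  · linear_combination 5 * m₁
  · linear_combination -10 * hτ
  · linear_combination 10 * m₂
  · linear_combination 15 * hz
  · linear_combination 10 * m₃
  · linear_combination hs

end Solving

/-! ### Assembly of the statements for both degrees. -/

theorem quarticFamily_mem (k : Type*) [Field k] [CharZero k] (n : ℕ) (α : Fin 5 → k) :
    quarticFamily n α ∈ symmetricForms k n 4 := by
  rw [areCoordinates_quarticCoords k n α]
  simp only [← smul_eq_C_mul]
  exact sum_mem fun j _ => Submodule.smul_mem _ _ (quarticProducts_mem k n j)

theorem quinticFamily_mem (k : Type*) [Field k] [CharZero k] (n : ℕ) (α : Fin 7 → k) :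
    quinticFamily n α ∈ symmetricForms k n 5 := by
  rw [areCoordinates_quinticCoords k n α]
  simp only [← smul_eq_C_mul]
  exact sum_mem fun j _ => Submodule.smul_mem _ _ (quinticProducts_mem k n j)

theorem holdsGenerically_quarticFamily (k : Type*) [Field k] [IsAlgClosed k] [CharZero k] (n : ℕ) :
    HoldsGenerically (symmetricForms k n 4) (fun F => ∃ α, F = quarticFamily n α) :=
  have ⟨_, ht⟩ := exists_eval_quarticDiscriminant_ne_zero k n
  holdsGenerically_exists_eq inf_le_left (quarticProducts_mem k n)
    (symmetricForms_four_le_span k n) (areCoordinates_quarticCoords k n) _ ht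
    (exists_quarticCoords_eq k n)

theorem holdsGenerically_quinticFamily (k : Type*) [Field k] [IsAlgClosed k] [CharZero k] (n : ℕ) :
    HoldsGenerically (symmetricForms k n 5) (fun F => ∃ α, F = quinticFamily n α) :=
  have ⟨_, ht⟩ := exists_eval_quinticDiscriminant_ne_zero k n
  holdsGenerically_exists_eq inf_le_left (quinticProducts_mem k n)
    (symmetricForms_five_le_span k n) (areCoordinates_quinticCoords k n) _ ht
    (exists_quinticCoords_eq k n)

theorem proposition5p1 (k : Type*) [Field k] [IsAlgClosed k] [CharZero k] (n : ℕ) :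
    -- quartics
    (HoldsGenerically (symmetricForms k n 4)
        (fun F => waringRank 4 F ≤ (((n + 1).choose 2 + 1 : ℕ) : ℕ∞)) ∧
      ((((n + 1).choose 2 + 1 : ℕ) : ℤ) = ((n + 2).choose 2 : ℤ) - (n : ℤ)) ∧
      (∀ α : Fin 5 → k,
        waringRank 4 (quarticFamily n α) ≤ (((n + 1).choose 2 + 1 : ℕ) : ℕ∞)) ∧
      (∃ c : Fin 5 → MvPolynomial (Fin 5) k,
        AreCoordinates (quarticFamily n) (quarticProducts k n) c ∧ jacobianDet c ≠ 0) ∧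
      IsDominantInto (symmetricForms k n 4) (quarticFamily (k := k) n) ∧
      HoldsGenerically (symmetricForms k n 4) (fun F => ∃ α, F = quarticFamily n α)) ∧
    -- quintics
    (HoldsGenerically (symmetricForms k n 5)
        (fun F => waringRank 5 F ≤ (((n + 2).choose 2 : ℕ) : ℕ∞)) ∧
      (∀ α : Fin 7 → k,
        waringRank 5 (quinticFamily n α) ≤ (((n + 2).choose 2 : ℕ) : ℕ∞)) ∧
      (∃ c : Fin 7 → MvPolynomial (Fin 7) k,
        AreCoordinates (quinticFamily n) (quinticProducts k n) c ∧ jacobianDet c ≠ 0) ∧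
      IsDominantInto (symmetricForms k n 5) (quinticFamily (k := k) n) ∧
      HoldsGenerically (symmetricForms k n 5) (fun F => ∃ α, F = quinticFamily n α)) := by
  have : Infinite k := IsAlgClosed.instInfinite
  have h4 := holdsGenerically_quarticFamily k n
  have h5 := holdsGenerically_quinticFamily k n
  refine ⟨⟨h4.mono ?_, ?_, waringRank_quarticFamily_le,
    ⟨_, areCoordinates_quarticCoords k n, jacobianDet_quarticCoords_ne_zero k n⟩,
    isDominantInto_of_holdsGenerically (quarticFamily_mem k n) h4, h4⟩,
    h5.mono ?_, waringRank_quinticFamily_le,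
    ⟨_, areCoordinates_quinticCoords k n, jacobianDet_quinticCoords_ne_zero k n⟩,
    isDominantInto_of_holdsGenerically (quinticFamily_mem k n) h5, h5⟩
  · rintro _ ⟨α, rfl⟩
    exact waringRank_quarticFamily_le α
  · rw [Nat.choose_succ_succ' (n + 1) 1, Nat.choose_one_right]
    push_cast
    ring
  · rintro _ ⟨α, rfl⟩
    exact waringRank_quinticFamily_le α
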